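/- Let $\mathbb H=\{z\in\mathbb C:\operatorname{Im} z\ge 0\}$. For a polynomial $p$ that is not identically $0$ let $\mathcal Z(p)=\{z\in\mathbb C: p(z)=0\}$, and let $\mathcal Z(0)=\emptyset$. The Pólya–Obrechkoff class $\mathcal{PO}$ is the collection of entire functions of the form $$F(z)=c\,z^m e^{-\alpha z^2+\beta z}\prod_j\Bigl(1-\frac z{a_j}\Bigr)e^{z/a_j}\qquad(z\in\mathbb C),$$ where $c,\beta\in\mathbb C$ ($c=0$ is allowed), $m$ is a nonnegative integer, $\alpha\ge 0$, $(a_j)$ is a finite (possibly empty) or infinite sequence in $\mathbb H\setminus\{0\}$, $\sum_j|a_j|^{-2}<\infty$ and $\sum_j\operatorname{Im}(-a_j^{-1})\le\operatorname{Im}\beta$. Let $f(z)=\sum_{k\ge 0}a_kz^k$ be a formal power series with complex coefficients $a_k$. For $n=0,1,2,\dots$ let $$J(f,n)(z)=\sum_{k=0}^n\frac{n!}{(n-k)!}\,a_k z^k$$ be its $n$-th Jensen polynomial. Say that a sequence $(f_i)$ of polynomials converges weakly to $f$ if $\frac1{k!}f_i^{(k)}(0)\to a_k$ as $i\to\infty$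 for every $k\ge 0$. Theorem 3.3. The following are equivalent: 1. $f$ represents an entire function in $\mathcal{PO}$; that is, there is $F\in\mathcal{PO}$ such that $\sum_k a_kz^k$ converges to $F(z)$ for every $z\in\mathbb C$. 2. There is a sequence $(f_i)$ of complex polynomials that converges weakly to $f$ and satisfies $\mathcal Z(f_i)\subset\mathbb H$ for all $i$. 3. $\mathcal Z(J(f,n))\subset\mathbb H$ for all $n\ge 0$. -/

import Mathlib

open Filter Topology
open scoped Nat

/-- The closed upper half plane `{z | Im z ≥ 0}`. -/
def closedUpperHalfPlane : Set ℂ := {z : ℂ | 0 ≤ z.im}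

/-- The zero set of a complex function, with the convention that the zero set of the
function that is identically `0` is empty. -/
def zeroSet (f : ℂ → ℂ) : Set ℂ := {z : ℂ | f z = 0 ∧ ∃ w : ℂ, f w ≠ 0}

/-- The Pólya-Obrechkoff class: the entire functions of the form
`c z ^ m exp (-α z ^ 2 + β z) ∏ j, (1 - z / a j) exp (z / a j)`
with `c` a complex constant (`c = 0` is allowed), `α ≥ 0`, finitely or countably many `a j`
that are nonzero and lie in the closed upper half plane (repetitions allowed),
`∑ j, |a j| ^ (-2) < ∞` and `∑ j, Im (-1 / a j) ≤ Im β`.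
The terms of the last sum are nonnegative, so that this inequality contains the convergence
of the sum, which is spelled out here. -/
def PolyaObrechkoff : Set (ℂ → ℂ) :=
  {f : ℂ → ℂ | Differentiable ℂ f ∧
    ∃ (c : ℂ) (m : ℕ) (α : ℝ) (β : ℂ) (ι : Type) (_ : Countable ι) (a : ι → ℂ),
      0 ≤ α ∧
      (∀ j, a j ∈ closedUpperHalfPlane \ {0}) ∧
      Summable (fun j => (‖a j‖ ^ 2)⁻¹) ∧
      Summable (fun j => (-(a j)⁻¹).im) ∧
      ∑' j, (-(a j)⁻¹).im ≤ β.im ∧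
      ∀ z : ℂ, ∃ P : ℂ,
        HasProd (fun j => (1 - z / a j) * Complex.exp (z / a j)) P ∧
        f z = c * z ^ m * Complex.exp (-(α : ℂ) * z ^ 2 + β * z) * P}

/-- The formal power series `f` represents the function `F` on the whole complex plane (so that
its radius of convergence is infinite). -/
def Represents (f : PowerSeries ℂ) (F : ℂ → ℂ) : Prop :=
  ∀ z : ℂ, HasSum (fun k : ℕ => PowerSeries.coeff k f * z ^ k) (F z)

/-- Weak convergence of a sequence of functions to a formal power series: for every `k`,
the `k`-th coefficient of the series is `(1 / k!) lim F_n ^ (k) (0)`, the limit being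
understood to exist. -/
def ConvergesWeakly (F : ℕ → ℂ → ℂ) (f : PowerSeries ℂ) : Prop :=
  ∀ k : ℕ, Tendsto (fun n : ℕ => 1 / (k ! : ℂ) * iteratedDeriv k (F n) 0) atTop
    (𝓝 (PowerSeries.coeff k f))

/-- The `n`-th Jensen polynomial `∑ k ≤ n, (n! / (n - k)!) a_k z ^ k` of the formal power
series `∑ k, a_k z ^ k`. -/
noncomputable def jensenPolynomial (f : PowerSeries ℂ) (n : ℕ) : Polynomial ℂ :=
  ∑ k ∈ Finset.range (n + 1),
    Polynomial.C ((n ! : ℂ) / ((n - k)! : ℂ) * PowerSeries.coeff k f) * Polynomial.X ^ k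

/-!
(1) ⇒ (2): multiplying out the factors `exp (z / a j)` of a partial product adds `∑ 1 / a j` to `β`,
and the hypothesis on `Im β` says that the new coefficient still has nonnegative imaginary part.
Approximating `exp t` by `(1 + t / n) ^ n` then gives polynomials with zeros in the upper half
plane; they are bounded on the unit circle, so that Cauchy's formula yields convergence of
coefficients.

(2) ⇒ (3): with `D = d/dz`, the reversal of the Jensen polynomial `J(p, n)` is `p(D) z ^ n`, so that
the Hermite–Poulain theorem locates its zeros. Zeros of polynomials of bounded degree stay in a
closed set under coefficientwise limits.

(3) ⇒ (1): after division by `c z ^ m`, the polynomials `J(f, n)(z / n)`, which tend to `f`, are of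
the form `∏ (1 - x j z)` with `Im (x j) ≤ 0`. Their coefficients of degree one and two determine
`∑ x j` and `∑ x j ^ 2`; as the `Im (x j)` have one sign, these sums bound `∑ |x j| ^ 2`. With the
`x j` in order of decreasing modulus, a subsequence converges termwise, and `|x j| ≤ √(C / (j + 1))`
lets one pass to the limit in the canonical products of genus two. The mass that `∑ x j ^ 2` loses
in the limit comes from small `x j`, whose squares add up to almost nonnegative reals because
`∑ |Im (x j)|` is bounded: this loss is `2 α ≥ 0`.
-/

open Polynomial

section RootsIn

/-- The polynomials all of whose roots lie in `S`. The zero polynomial has no entry in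
`Polynomial.roots`, so it belongs to every `rootsIn S`, in accordance with `zeroSet`. -/
def rootsIn {R : Type*} [CommRing R] [IsDomain R] (S : Set R) : Submonoid R[X] where
  carrier := {p | ∀ z ∈ p.roots, z ∈ S}
  one_mem' := by simp
  mul_mem' {p q} hp hq z hz := by
    have hpq : p * q ≠ 0 := ne_zero_of_mem_roots hz
    rw [roots_mul hpq, Multiset.mem_add] at hz
    exact hz.elim (hp z) (hq z)

/-- The closed lower half plane, which contains the reciprocals of the points of
`closedUpperHalfPlane`. -/
def closedLowerHalfPlane : Set ℂ := {z : ℂ | z.im ≤ 0}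

variable {R : Type*} [CommRing R] [IsDomain R] {S : Set R}

lemma C_mem_rootsIn (a : R) : C a ∈ rootsIn S :=
  fun z hz => by simp at hz

lemma X_mem_rootsIn (hS : 0 ∈ S) : X ∈ rootsIn S :=
  fun z hz => by
    rw [roots_X, Multiset.mem_singleton] at hz
    rwa [hz]

lemma mem_rootsIn_of_dvd {p q : R[X]} (h : p ∣ q) (hq0 : q ≠ 0) (hq : q ∈ rootsIn S) :
    p ∈ rootsIn S :=
  fun z hz => hq z (Multiset.mem_of_le (roots.le_of_dvd hq0 h) hz)

lemma comp_C_mul_X_mem_rootsIn {p : R[X]} (hp : p ∈ rootsIn S) {a : R}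
    (ha : ∀ z, a * z ∈ S → z ∈ S) : p.comp (C a * X) ∈ rootsIn S := by
  intro z hz
  have hz' : p.eval (a * z) = 0 := by simpa using (isRoot_of_mem_roots hz).eq_zero
  have hp0 : p ≠ 0 := by
    rintro rfl
    simp at hz
  exact ha z (hp _ ((mem_roots hp0).mpr hz'))

lemma one_sub_C_mul_X_mem_rootsIn {K : Type*} [Field K] {S : Set K} {x : K}
    (hx : x⁻¹ ∈ S) : 1 - C x * X ∈ rootsIn S := by
  intro z hz
  have hroot : x * z = 1 := by
    simpa [sub_eq_zero, eq_comm (a := (1 : K))] using (isRoot_of_mem_roots hz).eq_zero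
  rwa [eq_inv_of_mul_eq_one_right hroot]

end RootsIn

lemma zeroSet_eval_subset_iff {p : ℂ[X]} {S : Set ℂ} :
    zeroSet (fun z => p.eval z) ⊆ S ↔ p ∈ rootsIn S := by
  have hne : (∃ w, p.eval w ≠ 0) ↔ p ≠ 0 := by
    rw [ne_eq, ← not_forall_not]
    simp only [not_not]
    exact not_congr ⟨fun h => Polynomial.funext (by simpa using h), fun h => by simp [h]⟩
  refine forall_congr' fun z => imp_congr_left ?_
  rw [mem_roots', and_comm, ← hne]
  rfl

lemma inv_mem_closedUpperHalfPlane {z : ℂ} :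
    z⁻¹ ∈ closedUpperHalfPlane ↔ z ∈ closedLowerHalfPlane := by
  obtain rfl | hz := eq_or_ne z 0
  · simp [closedUpperHalfPlane, closedLowerHalfPlane]
  · change 0 ≤ z⁻¹.im ↔ z.im ≤ 0
    rw [Complex.inv_im, le_div_iff₀ (Complex.normSq_pos.mpr hz), zero_mul, neg_nonneg]

section Limits

lemma norm_eval_le_of_dist_roots {K : Type*} [NormedField K] {p : K[X]} (hp : p.Splits)
    {δ : ℝ} (hδ : 0 < δ) {z₀ : K} (h : ∀ r ∈ p.roots, δ ≤ dist z₀ r) (z : K) :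
    ‖p.eval z‖ ≤ ‖p.eval z₀‖ * (1 + dist z z₀ / δ) ^ p.natDegree := by
  have eval_eq (x : K) : p.eval x = p.leadingCoeff * (p.roots.map fun r => x - r).prod := by
    conv_lhs => rw [hp.eq_prod_roots]
    simp [eval_multiset_prod]
  have norm_factor_le (r : K) (hr : r ∈ p.roots) :
      ‖z - r‖ ≤ ‖z₀ - r‖ * (1 + dist z z₀ / δ) := by
    have hr' := h r hr
    rw [← dist_eq_norm, ← dist_eq_norm, mul_one_add]
    calc dist z r ≤ dist z₀ r + dist z z₀ := by linarith [dist_triangle z z₀ r]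
      _ = dist z₀ r + δ * (dist z z₀ / δ) := by rw [mul_div_cancel₀ _ hδ.ne']
      _ ≤ dist z₀ r + dist z₀ r * (dist z z₀ / δ) := by gcongr
  have norm_prod (x : K) :
      ‖p.eval x‖ = ‖p.leadingCoeff‖ * (p.roots.map fun r => ‖x - r‖).prod := by
    rw [eval_eq, norm_mul, ← normHom_apply (_ : Multiset K).prod, map_multiset_prod,
      Multiset.map_map]
    rfl
  rw [norm_prod, norm_prod, mul_assoc, hp.natDegree_eq_card_roots]
  gcongr
  calc (p.roots.map fun r => ‖z - r‖).prod
      ≤ (p.roots.map fun r => ‖z₀ - r‖ * (1 + dist z z₀ / δ)).prod :=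
        Multiset.prod_map_le_prod_map₀ _ _ (fun _ _ => norm_nonneg _) norm_factor_le
    _ = _ := by simp [Multiset.prod_map_mul]

lemma natDegree_le_of_tendsto {ι R : Type*} [Semiring R] [TopologicalSpace R] [T2Space R]
    {l : Filter ι} [l.NeBot] {p : ι → R[X]} {q : R[X]} {n : ℕ} (hn : ∀ i, (p i).natDegree ≤ n)
    (h : ∀ k, Tendsto (fun i => (p i).coeff k) l (𝓝 (q.coeff k))) : q.natDegree ≤ n := by
  rw [natDegree_le_iff_coeff_eq_zero]
  intro k hk
  refine tendsto_nhds_unique (h k) ?_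
  simp only [fun i => coeff_eq_zero_of_natDegree_lt ((hn i).trans_lt hk), tendsto_const_nhds]

lemma tendsto_eval_of_tendsto_coeff {ι R : Type*} [Semiring R] [TopologicalSpace R]
    [IsTopologicalSemiring R] [T2Space R] {l : Filter ι} {p : ι → R[X]} {q : R[X]} {n : ℕ}
    (hn : ∀ i, (p i).natDegree ≤ n) (h : ∀ k, Tendsto (fun i => (p i).coeff k) l (𝓝 (q.coeff k)))
    (z : R) : Tendsto (fun i => (p i).eval z) l (𝓝 (q.eval z)) := by
  rcases l.eq_or_neBot with rfl | _
  · exact tendsto_bot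
  have hq := natDegree_le_of_tendsto hn h
  simp only [fun i => eval_eq_sum_range' (Nat.lt_succ_of_le (hn i)) z,
    eval_eq_sum_range' (Nat.lt_succ_of_le hq) z]
  exact tendsto_finsetSum _ fun k _ => (h k).mul_const _

/-- The roots of the approximating polynomials keep a positive distance from any point outside of
`S`; if `q` vanished there, then `norm_eval_le_of_dist_roots` would force `q = 0`. -/
lemma mem_rootsIn_of_tendsto {ι K : Type*} [NormedField K] [IsAlgClosed K] {S : Set K}
    (hS : IsClosed S) {l : Filter ι} [l.NeBot] {p : ι → K[X]} {q : K[X]} {n : ℕ}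
    (hp : ∀ i, p i ∈ rootsIn S) (hn : ∀ i, (p i).natDegree ≤ n)
    (h : ∀ k, Tendsto (fun i => (p i).coeff k) l (𝓝 (q.coeff k))) : q ∈ rootsIn S := by
  intro z₀ hz₀
  by_contra hz₀S
  obtain ⟨δ, hδ, hball⟩ := Metric.isOpen_iff.mp hS.isOpen_compl z₀ hz₀S
  have eval_le (z : K) (i : ι) :
      ‖(p i).eval z‖ ≤ ‖(p i).eval z₀‖ * (1 + dist z z₀ / δ) ^ n := by
    have hdist (r : K) (hr : r ∈ (p i).roots) : δ ≤ dist z₀ r := by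
      by_contra! hlt
      exact hball (Metric.mem_ball'.mpr hlt) (hp i r hr)
    refine (norm_eval_le_of_dist_roots (IsAlgClosed.splits _) hδ hdist z).trans ?_
    gcongr
    exacts [le_add_of_nonneg_right (by positivity), hn i]
  have hlim := tendsto_eval_of_tendsto_coeff hn h
  refine ne_zero_of_mem_roots hz₀ (Polynomial.funext fun z => ?_)
  have := le_of_tendsto_of_tendsto' (hlim z).norm ((hlim z₀).norm.mul_const _) (eval_le z)
  simpa [(isRoot_of_mem_roots hz₀).eq_zero] using this

end Limits

section HermitePoulain

lemma im_eval_derivative_div_eval_neg {q : ℂ[X]} (hq : q ∈ rootsIn closedLowerHalfPlane)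
    (hdeg : q.natDegree ≠ 0) {z : ℂ} (hz : 0 < z.im) (hqz : q.eval z ≠ 0) :
    (q.derivative.eval z / q.eval z).im < 0 := by
  have im_inv_neg (r : ℂ) (hr : r ∈ q.roots) : (1 / (z - r)).im < 0 := by
    have hr' : r.im ≤ 0 := hq r hr
    have him : 0 < (z - r).im := by rw [Complex.sub_im]; linarith
    have hne : z - r ≠ 0 := fun h => by simp [h] at him
    rw [one_div, Complex.inv_im]
    exact div_neg_of_neg_of_pos (neg_neg_of_pos him) (Complex.normSq_pos.mpr hne)
  have hroots : q.roots ≠ 0 := by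
    rwa [← Multiset.card_pos, ← (IsAlgClosed.splits q).natDegree_eq_card_roots, pos_iff_ne_zero]
  calc (q.derivative.eval z / q.eval z).im
      = (q.roots.map fun r => (1 / (z - r)).im).sum := by
        rw [(IsAlgClosed.splits q).eval_derivative_div_eval_of_ne_zero hqz]
        exact (map_multiset_sum Complex.imAddGroupHom _).trans (by rw [Multiset.map_map]; rfl)
    _ < (q.roots.map fun _ => (0 : ℝ)).sum := Multiset.sum_lt_sum_of_nonempty hroots im_inv_neg
    _ = 0 := by simp

lemma derivative_sub_C_mul_mem_rootsIn {q : ℂ[X]} (hq : q ∈ rootsIn closedLowerHalfPlane)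
    {a : ℂ} (ha : a ∈ closedUpperHalfPlane) :
    derivative q - C a * q ∈ rootsIn closedLowerHalfPlane := by
  by_cases hdeg : q.natDegree = 0
  · rw [eq_C_of_natDegree_eq_zero hdeg, derivative_C, zero_sub, ← C_mul, ← C_neg]
    exact C_mem_rootsIn _
  intro z hz
  by_contra hz_im
  replace hz_im : 0 < z.im := not_le.mp hz_im
  have hroot : q.derivative.eval z = a * q.eval z := by
    simpa [sub_eq_zero] using (isRoot_of_mem_roots hz).eq_zero
  have hqz : q.eval z ≠ 0 := fun h => hz_im.not_ge <|
    hq z ((mem_roots (ne_zero_of_natDegree_gt (pos_iff_ne_zero.mpr hdeg))).mpr h)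
  have := im_eval_derivative_div_eval_neg hq hdeg hz_im hqz
  rw [hroot, mul_div_cancel_right₀ _ hqz] at this
  exact this.not_ge ha

/-- The Hermite–Poulain theorem for half planes. -/
lemma aeval_derivative_mem_rootsIn {p q : ℂ[X]} (hp : p ∈ rootsIn closedUpperHalfPlane)
    (hq : q ∈ rootsIn closedLowerHalfPlane) :
    aeval (derivative : Module.End ℂ ℂ[X]) p q ∈ rootsIn closedLowerHalfPlane := by
  have prod_mem (s : Multiset ℂ) (hs : ∀ a ∈ s, a ∈ closedUpperHalfPlane) :
      aeval (derivative : Module.End ℂ ℂ[X]) (s.map fun a => X - C a).prod q ∈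
        rootsIn closedLowerHalfPlane := by
    induction s using Multiset.induction with
    | empty => simpa using hq
    | cons a s ih =>
      rw [Multiset.forall_mem_cons] at hs
      simpa [Module.algebraMap_end_apply, smul_eq_C_mul] using
        derivative_sub_C_mul_mem_rootsIn (ih hs.2) hs.1
  rw [(IsAlgClosed.splits p).eq_prod_roots, map_mul, aeval_C, Module.End.mul_apply,
    Module.algebraMap_end_apply, smul_eq_C_mul]
  exact mul_mem (C_mem_rootsIn _) (prod_mem _ hp)

end HermitePoulain

section Jensen

open scoped PowerSeries.WithPiTopology

lemma coeff_jensenPolynomial (f : PowerSeries ℂ) (n k : ℕ) :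
    (jensenPolynomial f n).coeff k = n.descFactorial k * PowerSeries.coeff k f := by
  simp only [jensenPolynomial, finsetSum_coeff, coeff_C_mul_X_pow, Finset.sum_ite_eq,
    Finset.mem_range, Nat.lt_succ_iff]
  split_ifs with hk
  · rw [← Nat.factorial_mul_descFactorial hk, Nat.cast_mul,
      mul_div_cancel_left₀ _ (Nat.cast_ne_zero.mpr (Nat.factorial_ne_zero _))]
  · simp [Nat.descFactorial_of_lt (not_le.mp hk)]

lemma natDegree_jensenPolynomial_le (f : PowerSeries ℂ) (n : ℕ) :
    (jensenPolynomial f n).natDegree ≤ n := by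
  rw [natDegree_le_iff_coeff_eq_zero]
  intro k hk
  rw [coeff_jensenPolynomial, Nat.descFactorial_of_lt hk, Nat.cast_zero, zero_mul]

lemma jensenPolynomial_add (f g : PowerSeries ℂ) (n : ℕ) :
    jensenPolynomial (f + g) n = jensenPolynomial f n + jensenPolynomial g n := by
  ext k
  simp [coeff_jensenPolynomial, mul_add]

lemma jensenPolynomial_monomial (k : ℕ) (a : ℂ) (n : ℕ) :
    jensenPolynomial (PowerSeries.monomial k a) n = C (n.descFactorial k * a) * X ^ k := by
  ext j
  rw [coeff_jensenPolynomial, PowerSeries.coeff_monomial, coeff_C_mul_X_pow]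
  split_ifs with h <;> simp [h]

lemma aeval_derivative_X_pow (p : ℂ[X]) (n : ℕ) :
    aeval (derivative : Module.End ℂ ℂ[X]) p (X ^ n) =
      reflect n (jensenPolynomial (p : PowerSeries ℂ) n) := by
  induction p using Polynomial.induction_on' with
  | add p q hp hq =>
    rw [map_add, LinearMap.add_apply, hp, hq, Polynomial.coe_add, jensenPolynomial_add, reflect_add]
  | monomial k a =>
    rw [aeval_monomial, Module.End.mul_apply, Module.End.pow_apply, Module.algebraMap_end_apply,
      iterate_derivative_X_pow_eq_C_mul, smul_eq_C_mul, ← mul_assoc, ← C_mul, mul_comm a,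
      Polynomial.coe_monomial, jensenPolynomial_monomial, reflect_C_mul_X_pow]
    obtain hk | hk := le_or_gt k n
    · rw [revAt_le hk]
    · simp [Nat.descFactorial_of_lt hk]

lemma reflect_mem_rootsIn {p : ℂ[X]} {n : ℕ} (hn : p.natDegree ≤ n)
    (hp : reflect n p ∈ rootsIn closedLowerHalfPlane) : p ∈ rootsIn closedUpperHalfPlane := by
  intro z hz
  obtain rfl | hz0 := eq_or_ne z 0
  · simp [closedUpperHalfPlane]
  have hp0 : reflect n p ≠ 0 := by
    rw [ne_eq, reflect_eq_zero_iff]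
    exact ne_zero_of_mem_roots hz
  have : Invertible z := invertibleOfNonzero hz0
  have hroot := (eval₂_reflect_eq_zero_iff (RingHom.id ℂ) z n p hn).mpr (isRoot_of_mem_roots hz)
  rw [← inv_inv z, inv_mem_closedUpperHalfPlane]
  exact hp _ ((mem_roots hp0).mpr (by simpa [eval₂_id] using hroot))

lemma jensenPolynomial_coe_mem_rootsIn {p : ℂ[X]} (hp : p ∈ rootsIn closedUpperHalfPlane)
    (n : ℕ) : jensenPolynomial (p : PowerSeries ℂ) n ∈ rootsIn closedUpperHalfPlane := by
  refine reflect_mem_rootsIn (natDegree_jensenPolynomial_le _ n) ?_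
  rw [← aeval_derivative_X_pow]
  exact aeval_derivative_mem_rootsIn hp (pow_mem (X_mem_rootsIn (by simp [closedLowerHalfPlane])) n)

lemma jensenPolynomial_mem_rootsIn_of_tendsto {ι : Type*} {l : Filter ι} [l.NeBot] {p : ι → ℂ[X]}
    (hp : ∀ i, p i ∈ rootsIn closedUpperHalfPlane) {f : PowerSeries ℂ}
    (h : Tendsto (fun i => (p i : PowerSeries ℂ)) l (𝓝 f)) (n : ℕ) :
    jensenPolynomial f n ∈ rootsIn closedUpperHalfPlane := by
  refine mem_rootsIn_of_tendsto (l := l) (isClosed_le continuous_const Complex.continuous_im)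
    (fun i => jensenPolynomial_coe_mem_rootsIn (hp i) n)
    (fun i => natDegree_jensenPolynomial_le _ n) fun k => ?_
  simp only [coeff_jensenPolynomial]
  exact ((PowerSeries.WithPiTopology.tendsto_iff_coeff_tendsto _ _ _ _).mp h k).const_mul _

lemma tendsto_jensenPolynomial_comp (f : PowerSeries ℂ) :
    Tendsto (fun n : ℕ => ((jensenPolynomial f n).comp (C (n : ℂ)⁻¹ * X) : PowerSeries ℂ)) atTop
      (𝓝 f) := by
  refine (PowerSeries.WithPiTopology.tendsto_iff_coeff_tendsto _ _ _ _).mpr fun k => ?_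
  have hratio : Tendsto (fun n : ℕ => (n.descFactorial k : ℂ) * ((n : ℂ)⁻¹) ^ k) atTop (𝓝 1) := by
    have hne : ∀ᶠ n : ℕ in atTop, (n : ℝ) ^ k ≠ 0 := by
      filter_upwards [eventually_ne_atTop 0] with n hn using by positivity
    have := (Asymptotics.isEquivalent_iff_tendsto_one hne).mp (isEquivalent_descFactorial k)
    exact ((Complex.continuous_ofReal.tendsto 1).comp this).congr fun n => by
      simp [div_eq_mul_inv]
  simpa [comp_C_mul_X_coeff, coeff_jensenPolynomial, mul_right_comm] using
    hratio.mul_const (PowerSeries.coeff k f)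

lemma jensenPolynomial_C_mul (c : ℂ) (f : PowerSeries ℂ) (n : ℕ) :
    jensenPolynomial (PowerSeries.C c * f) n = C c * jensenPolynomial f n := by
  ext k
  simp only [coeff_jensenPolynomial, PowerSeries.coeff_C_mul, coeff_C_mul, mul_left_comm]

lemma jensenPolynomial_X_pow_mul (m : ℕ) (f : PowerSeries ℂ) (n : ℕ) :
    jensenPolynomial (PowerSeries.X ^ m * f) (n + m) =
      C ((n + m).descFactorial m : ℂ) * (X ^ m * jensenPolynomial f n) := by
  ext k
  rw [coeff_jensenPolynomial, PowerSeries.coeff_X_pow_mul', coeff_C_mul, coeff_X_pow_mul',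
    coeff_jensenPolynomial]
  split_ifs with hk
  · rw [← Nat.descFactorial_mul_descFactorial hk, Nat.add_sub_cancel]
    push_cast
    ring
  · simp

lemma jensenPolynomial_mem_rootsIn_of_C_mul_X_pow_mul {S : Set ℂ} {c : ℂ} (hc : c ≠ 0) (m : ℕ)
    {g : PowerSeries ℂ}
    (hf : ∀ n, jensenPolynomial (PowerSeries.C c * (PowerSeries.X ^ m * g)) n ∈ rootsIn S)
    (n : ℕ) : jensenPolynomial g n ∈ rootsIn S := by
  obtain hJ | hJ := eq_or_ne (jensenPolynomial g n) 0
  · rw [hJ, ← C_0]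
    exact C_mem_rootsIn 0
  have key := hf (n + m)
  rw [jensenPolynomial_C_mul, jensenPolynomial_X_pow_mul, ← mul_assoc, ← mul_assoc] at key
  exact mem_rootsIn_of_dvd (Dvd.intro_left _ rfl) (by simp [hc, hJ]) key

end Jensen

section TaylorSeries

open scoped PowerSeries.WithPiTopology

/-- The Taylor series at `0`, as a formal power series; its coefficients are the quantities
appearing in `ConvergesWeakly`. -/
noncomputable def taylorSeries (F : ℂ → ℂ) : PowerSeries ℂ :=
  PowerSeries.mk fun k => 1 / (k ! : ℂ) * iteratedDeriv k F 0

lemma convergesWeakly_iff {F : ℕ → ℂ → ℂ} {f : PowerSeries ℂ} :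
    ConvergesWeakly F f ↔ Tendsto (fun n => taylorSeries (F n)) atTop (𝓝 f) := by
  simp only [PowerSeries.WithPiTopology.tendsto_iff_coeff_tendsto, taylorSeries,
    PowerSeries.coeff_mk, ConvergesWeakly]

lemma Represents.taylorSeries_eq {f : PowerSeries ℂ} {F : ℂ → ℂ} (h : Represents f F) :
    taylorSeries F = f := by
  have hF : HasFPowerSeriesAt F
      (FormalMultilinearSeries.ofScalars ℂ fun k => PowerSeries.coeff k f) 0 := by
    refine hasFPowerSeriesAt_iff.mpr (Eventually.of_forall fun z => ?_)
    simpa [FormalMultilinearSeries.coeff_ofScalars, mul_comm] using h z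
  ext k
  have hcoeff := congrArg (fun p => p.coeff k)
    (hF.eq_formalMultilinearSeries hF.analyticAt.hasFPowerSeriesAt)
  simp only [FormalMultilinearSeries.coeff_ofScalars] at hcoeff
  rw [taylorSeries, PowerSeries.coeff_mk, hcoeff, one_div_mul_eq_div]

lemma represents_taylorSeries {F : ℂ → ℂ} (hF : Differentiable ℂ F) :
    Represents (taylorSeries F) F := fun z => by
  simpa [taylorSeries, mul_assoc, mul_comm (z ^ _)] using
    Complex.hasSum_taylorSeries_of_entire hF 0 z

lemma represents_coe (p : ℂ[X]) : Represents p fun z => p.eval z := fun z => by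
  simp only [Polynomial.coeff_coe, eval_eq_sum, Polynomial.sum_def]
  refine hasSum_sum_of_ne_finset_zero fun k hk => ?_
  rw [notMem_support_iff.mp hk, zero_mul]

lemma taylorSeries_eval (p : ℂ[X]) : taylorSeries (fun z => p.eval z) = p :=
  (represents_coe p).taylorSeries_eq

lemma Represents.mul {f g : PowerSeries ℂ} {F G : ℂ → ℂ} (hf : Represents f F)
    (hg : Represents g G) : Represents (f * g) fun z => F z * G z := by
  intro z
  have hterm (n : ℕ) : PowerSeries.coeff n (f * g) * z ^ n =
      ∑ kl ∈ Finset.HasAntidiagonal.antidiagonal n,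
        (PowerSeries.coeff kl.1 f * z ^ kl.1) * (PowerSeries.coeff kl.2 g * z ^ kl.2) := by
    rw [PowerSeries.coeff_mul, Finset.sum_mul]
    refine Finset.sum_congr rfl fun kl hkl => ?_
    rw [← Finset.HasAntidiagonal.mem_antidiagonal.mp hkl, pow_add, mul_mul_mul_comm]
  have hf' := (hf z).summable.norm
  have hg' := (hg z).summable.norm
  simp only [hterm]
  rw [← (hf z).tsum_eq, ← (hg z).tsum_eq,
    tsum_mul_tsum_eq_tsum_sum_antidiagonal_of_summable_norm hf' hg']
  exact (summable_norm_sum_mul_antidiagonal_of_summable_norm hf' hg').of_norm.hasSum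

lemma coeff_taylorSeries_eq_circleIntegral {F : ℂ → ℂ} (hF : Differentiable ℂ F) (k : ℕ) :
    PowerSeries.coeff k (taylorSeries F) =
      (2 * Real.pi * Complex.I)⁻¹ * ∮ z in C(0, 1), (1 / (z - 0) ^ (k + 1)) • F z := by
  rw [hF.differentiableOn.circleIntegral_one_div_sub_center_pow_smul one_pos k, taylorSeries,
    PowerSeries.coeff_mk, smul_eq_mul]
  have := Complex.two_pi_I_ne_zero
  field_simp

lemma tendsto_taylorSeries {ι : Type*} {l : Filter ι} [l.IsCountablyGenerated]
    {G : ι → ℂ → ℂ} {F : ℂ → ℂ} (hG : ∀ i, Differentiable ℂ (G i)) (hF : Differentiable ℂ F)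
    {M : ℝ} (hM : ∀ i z, ‖z‖ = 1 → ‖G i z‖ ≤ M)
    (hlim : ∀ z, ‖z‖ = 1 → Tendsto (fun i => G i z) l (𝓝 (F z))) :
    Tendsto (fun i => taylorSeries (G i)) l (𝓝 (taylorSeries F)) := by
  refine (PowerSeries.WithPiTopology.tendsto_iff_coeff_tendsto _ _ _ _).mpr fun k => ?_
  simp only [fun i => coeff_taylorSeries_eq_circleIntegral (hG i) k,
    coeff_taylorSeries_eq_circleIntegral hF k]
  refine Tendsto.const_mul _ ?_
  have hnorm (θ : ℝ) : ‖circleMap 0 1 θ‖ = 1 := by simp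
  have hne (θ : ℝ) : circleMap 0 1 θ ≠ 0 := circleMap_ne_center one_ne_zero
  refine intervalIntegral.tendsto_integral_filter_of_dominated_convergence (fun _ => M)
    (.of_forall fun i => Continuous.aestronglyMeasurable ?_)
    (.of_forall fun i => .of_forall fun θ _ => ?_) intervalIntegrable_const
    (.of_forall fun θ _ => ((hlim _ (hnorm θ)).const_smul _).const_smul _)
  · have hcont := (hG i).continuous
    simp only [deriv_circleMap, sub_zero]
    fun_prop (disch := exact fun θ => pow_ne_zero _ (hne θ))
  · simpa [hnorm] using hM i _ (hnorm θ)

end TaylorSeries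

section WeierstrassFactor

/-- The Weierstrass elementary factor `(1 - u) exp (u + u ^ 2 / 2 + ⋯ + u ^ n / n)`. -/
noncomputable def weierstrassFactor (n : ℕ) (u : ℂ) : ℂ :=
  (1 - u) * Complex.exp (∑ k ∈ Finset.range n, u ^ (k + 1) / (k + 1))

lemma hasDerivAt_weierstrassFactor (n : ℕ) (u : ℂ) :
    HasDerivAt (weierstrassFactor n)
      (-u ^ n * Complex.exp (∑ k ∈ Finset.range n, u ^ (k + 1) / (k + 1))) u := by
  have hsum : HasDerivAt (fun u : ℂ => ∑ k ∈ Finset.range n, u ^ (k + 1) / (k + 1))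
      (∑ k ∈ Finset.range n, u ^ k) u := by
    refine HasDerivAt.fun_sum fun k _ => ((hasDerivAt_pow (k + 1) u).div_const _).congr_deriv ?_
    push_cast
    field_simp [Nat.cast_add_one_ne_zero]
  refine (((hasDerivAt_id' u).const_sub 1).mul hsum.cexp).congr_deriv ?_
  linear_combination Complex.exp (∑ k ∈ Finset.range n, u ^ (k + 1) / (k + 1)) *
    mul_neg_geom_sum u n

lemma norm_weierstrassFactor_sub_one_le (n : ℕ) (u : ℂ) :
    ‖weierstrassFactor n u - 1‖ ≤
      ‖u‖ ^ (n + 1) * Real.exp (∑ k ∈ Finset.range n, ‖u‖ ^ (k + 1) / (k + 1)) := by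
  have norm_deriv_le (v : ℂ) (hv : v ∈ Metric.closedBall (0 : ℂ) ‖u‖) :
      ‖-v ^ n * Complex.exp (∑ k ∈ Finset.range n, v ^ (k + 1) / (k + 1))‖ ≤
        ‖u‖ ^ n * Real.exp (∑ k ∈ Finset.range n, ‖u‖ ^ (k + 1) / (k + 1)) := by
    rw [mem_closedBall_zero_iff] at hv
    rw [norm_mul, norm_neg, norm_pow]
    gcongr
    refine (Complex.norm_exp_le_exp_norm _).trans (Real.exp_le_exp.mpr ?_)
    refine (norm_sum_le _ _).trans (Finset.sum_le_sum fun k _ => ?_)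
    rw [norm_div, norm_pow, ← Nat.cast_add_one, ← Nat.cast_add_one, Complex.norm_natCast]
    gcongr
  have hzero : weierstrassFactor n 0 = 1 := by simp [weierstrassFactor]
  have := (convex_closedBall (0 : ℂ) ‖u‖).norm_image_sub_le_of_norm_hasDerivWithin_le
    (fun v _ => (hasDerivAt_weierstrassFactor n v).hasDerivWithinAt) norm_deriv_le
    (Metric.mem_closedBall_self (norm_nonneg u)) (mem_closedBall_zero_iff.mpr le_rfl)
  rw [hzero, sub_zero] at this
  exact this.trans_eq (by ring)

lemma weierstrassFactor_one (u : ℂ) : weierstrassFactor 1 u = (1 - u) * Complex.exp u := by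
  simp [weierstrassFactor]

lemma norm_weierstrassFactor_one_le (u : ℂ) :
    ‖weierstrassFactor 1 u‖ ≤ Real.exp (‖u‖ ^ 2 / 2) := by
  have hsq : ‖1 - u‖ ^ 2 ≤ Real.exp (‖u‖ ^ 2 - 2 * u.re) := by
    refine le_of_eq_of_le ?_ (Real.add_one_le_exp _)
    simp only [Complex.sq_norm, Complex.normSq_apply, Complex.sub_re, Complex.one_re,
      Complex.sub_im, Complex.one_im]
    ring
  rw [weierstrassFactor_one, norm_mul, Complex.norm_exp]
  refine le_of_sq_le_sq ?_ (Real.exp_pos _).le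
  calc (‖1 - u‖ * Real.exp u.re) ^ 2 = ‖1 - u‖ ^ 2 * Real.exp u.re ^ 2 := mul_pow _ _ 2
    _ ≤ Real.exp (‖u‖ ^ 2 - 2 * u.re) * Real.exp u.re ^ 2 := by gcongr
    _ = Real.exp (‖u‖ ^ 2 / 2) ^ 2 := by
      rw [← Real.exp_nat_mul, ← Real.exp_nat_mul, ← Real.exp_add]
      congr 1
      push_cast
      ring

variable {ι : Type*} {n : ℕ}

lemma exists_norm_weierstrassFactor_mul_sub_one_le {r : ι → ℝ}
    (hr : Summable fun j => r j ^ (n + 1)) (hr0 : ∀ j, 0 ≤ r j) (R : ℝ) :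
    ∃ K : ℝ, ∀ j (x z : ℂ), ‖x‖ ≤ r j → ‖z‖ ≤ R →
      ‖weierstrassFactor n (x * z) - 1‖ ≤ K * r j ^ (n + 1) := by
  have le_bound (j : ι) : r j ≤ 1 + ∑' i, r i ^ (n + 1) := by
    have hnonneg (i : ι) : 0 ≤ r i ^ (n + 1) := pow_nonneg (hr0 i) _
    obtain h | h := le_total (r j) 1
    · exact h.trans (le_add_of_nonneg_right (tsum_nonneg hnonneg))
    · exact (le_self_pow₀ h n.succ_ne_zero).trans
        ((hr.le_tsum j fun i _ => hnonneg i).trans (le_add_of_nonneg_left zero_le_one))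
  set B := 1 + ∑' i, r i ^ (n + 1)
  refine ⟨R ^ (n + 1) * Real.exp (∑ k ∈ Finset.range n, (B * R) ^ (k + 1) / (k + 1)),
    fun j x z hx hz => (norm_weierstrassFactor_sub_one_le n (x * z)).trans ?_⟩
  rw [mul_right_comm, ← mul_pow, norm_mul, mul_comm R]
  have hxB := hx.trans (le_bound j)
  have hR := (norm_nonneg z).trans hz
  have hrj := hr0 j
  have hB := hrj.trans (le_bound j)
  gcongr

lemma multipliable_weierstrassFactor {x : ι → ℂ} (hx : Summable fun j => ‖x j‖ ^ (n + 1))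
    (z : ℂ) : Multipliable fun j => weierstrassFactor n (x j * z) := by
  obtain ⟨K, hK⟩ :=
    exists_norm_weierstrassFactor_mul_sub_one_le hx (fun j => norm_nonneg (x j)) ‖z‖
  have hsum : Summable fun j => ‖weierstrassFactor n (x j * z) - 1‖ :=
    (hx.mul_left K).of_nonneg_of_le (fun _ => norm_nonneg _) fun j => hK j _ z le_rfl le_rfl
  simpa using multipliable_one_add_of_summable hsum

lemma differentiable_tprod_weierstrassFactor {x : ι → ℂ}
    (hx : Summable fun j => ‖x j‖ ^ (n + 1)) :
    Differentiable ℂ fun z => ∏' j, weierstrassFactor n (x j * z) := by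
  intro z₀
  obtain ⟨K, hK⟩ :=
    exists_norm_weierstrassFactor_mul_sub_one_le hx (fun j => norm_nonneg (x j)) (‖z₀‖ + 1)
  have hdiff (j : ι) : Differentiable ℂ fun z => weierstrassFactor n (x j * z) := fun z =>
    (hasDerivAt_weierstrassFactor n (x j * z)).differentiableAt.comp z (by fun_prop)
  have hprod := (hx.mul_left K).hasProdLocallyUniformlyOn_one_add
    (f := fun j z => weierstrassFactor n (x j * z) - 1) (K := Metric.ball 0 (‖z₀‖ + 1))
    Metric.isOpen_ball
    (.of_forall fun j z hz => hK j _ z le_rfl (mem_ball_zero_iff.mp hz).le)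
    fun j => ((hdiff j).continuous.sub continuous_const).continuousOn
  simp only [add_sub_cancel] at hprod
  refine (hprod.differentiableOn ?_ Metric.isOpen_ball).differentiableAt
    (Metric.isOpen_ball.mem_nhds (by simp))
  exact .of_forall fun s => (Differentiable.fun_finsetProd fun j _ => hdiff j).differentiableOn

lemma tendsto_tprod_weierstrassFactor {κ : Type*} {l : Filter κ} {x : κ → ι → ℂ} {y : ι → ℂ}
    {r : ι → ℝ} (hr : Summable fun j => r j ^ (n + 1)) (hxr : ∀ i j, ‖x i j‖ ≤ r j)
    (hxy : ∀ j, Tendsto (fun i => x i j) l (𝓝 (y j))) (z : ℂ) :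
    Tendsto (fun i => ∏' j, weierstrassFactor n (x i j * z)) l
      (𝓝 (∏' j, weierstrassFactor n (y j * z))) := by
  obtain rfl | _ := l.eq_or_neBot
  · exact tendsto_bot
  obtain ⟨i₀⟩ := l.nonempty_of_neBot
  obtain ⟨K, hK⟩ := exists_norm_weierstrassFactor_mul_sub_one_le hr
    (fun j => (norm_nonneg _).trans (hxr i₀ j)) ‖z‖
  have hcont : Continuous (weierstrassFactor n) := continuous_iff_continuousAt.mpr fun u =>
    (hasDerivAt_weierstrassFactor n u).continuousAt
  have := tendsto_tprod_one_add_of_dominated_convergence (𝓕 := l)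
    (f := fun i j => weierstrassFactor n (x i j * z) - 1)
    (g := fun j => weierstrassFactor n (y j * z) - 1) (hr.mul_left K)
    (fun j => ((hcont.tendsto _).comp ((hxy j).mul_const z)).sub_const 1)
    (.of_forall fun i j => hK j _ z (hxr i j) le_rfl)
  simpa using this

end WeierstrassFactor

section FiniteProducts

variable {ι : Type*} (s : Finset ι) (x : ι → ℂ) (z : ℂ)

lemma prod_one_sub_mul_eq :
    ∏ j ∈ s, (1 - x j * z) =
      Complex.exp (-(∑ j ∈ s, x j) * z) * ∏ j ∈ s, weierstrassFactor 1 (x j * z) := by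
  simp only [weierstrassFactor_one]
  rw [Finset.prod_mul_distrib, ← Complex.exp_sum, mul_left_comm, ← Complex.exp_add,
    ← Finset.sum_mul, ← add_mul, neg_add_cancel, zero_mul, Complex.exp_zero, mul_one]

lemma norm_prod_weierstrassFactor_one_le :
    ‖∏ j ∈ s, weierstrassFactor 1 (x j * z)‖ ≤
      Real.exp ((∑ j ∈ s, ‖x j‖ ^ 2) * ‖z‖ ^ 2 / 2) := by
  rw [norm_prod, Finset.sum_mul, Finset.sum_div, Real.exp_sum]
  refine Finset.prod_le_prod (fun _ _ => norm_nonneg _) fun j _ => ?_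
  rw [← mul_pow, ← norm_mul]
  exact norm_weierstrassFactor_one_le _

end FiniteProducts

section WeakLimits

open scoped PowerSeries.WithPiTopology

lemma norm_one_add_div_pow_le (t : ℂ) (n : ℕ) : ‖(1 + t / n) ^ n‖ ≤ Real.exp ‖t‖ := by
  obtain rfl | hn := eq_or_ne n 0
  · simp
  calc ‖(1 + t / n) ^ n‖ ≤ (1 + ‖t‖ / n) ^ n := by
        rw [norm_pow]
        gcongr
        simpa using norm_add_le 1 (t / n)
    _ ≤ Real.exp (‖t‖ / n) ^ n := by
        gcongr
        exact (add_comm _ _).trans_le (Real.add_one_le_exp _)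
    _ = Real.exp ‖t‖ := by rw [← Real.exp_nat_mul, mul_div_cancel₀ _ (Nat.cast_ne_zero.mpr hn)]

lemma one_sub_C_mul_X_sq_mem_rootsIn {α : ℝ} (hα : 0 ≤ α) :
    1 - C (α : ℂ) * X ^ 2 ∈ rootsIn closedUpperHalfPlane := by
  have hfactor : 1 - C (α : ℂ) * X ^ 2 = (1 - C (√α : ℂ) * X) * (1 - C (-√α : ℂ) * X) := by
    rw [← Real.sq_sqrt hα, Complex.ofReal_pow, C_pow, C_neg, Real.sq_sqrt hα]
    ring
  rw [hfactor]
  exact mul_mem (one_sub_C_mul_X_mem_rootsIn (by simp [closedUpperHalfPlane]))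
    (one_sub_C_mul_X_mem_rootsIn (by simp [closedUpperHalfPlane]))

lemma taylorSeries_exp_mul_prod_mem_closure {ι : Type*} (s : Finset ι) {x : ι → ℂ}
    (hx : ∀ j ∈ s, x j ∈ closedLowerHalfPlane) (c : ℂ) (m : ℕ) {α : ℝ} (hα : 0 ≤ α) {γ : ℂ}
    (hγ : 0 ≤ γ.im) :
    taylorSeries (fun z => c * z ^ m * Complex.exp (-(α : ℂ) * z ^ 2 + γ * z) *
      ∏ j ∈ s, (1 - x j * z)) ∈
      closure (coeToPowerSeries.ringHom '' (rootsIn closedUpperHalfPlane : Set ℂ[X])) := by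
  let p (n : ℕ) : ℂ[X] := C c * X ^ m * ((1 - C ((α / n : ℝ) : ℂ) * X ^ 2) ^ n *
    (1 - C (-(γ / n)) * X) ^ n) * ∏ j ∈ s, (1 - C (x j) * X)
  have p_mem (n : ℕ) : p n ∈ rootsIn closedUpperHalfPlane := by
    have linear_mem {w : ℂ} (hw : w ∈ closedLowerHalfPlane) :
        1 - C w * X ∈ rootsIn closedUpperHalfPlane :=
      one_sub_C_mul_X_mem_rootsIn (inv_mem_closedUpperHalfPlane.mpr hw)
    have hγn : -(γ / n) ∈ closedLowerHalfPlane := by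
      change (-(γ / n)).im ≤ 0
      rw [Complex.neg_im, Complex.div_natCast_im, neg_nonpos]
      positivity
    have hX : X ∈ rootsIn closedUpperHalfPlane := X_mem_rootsIn (by simp [closedUpperHalfPlane])
    exact mul_mem (mul_mem (mul_mem (C_mem_rootsIn c) (pow_mem hX m))
      (mul_mem (pow_mem (one_sub_C_mul_X_sq_mem_rootsIn (by positivity)) n)
        (pow_mem (linear_mem hγn) n))) (prod_mem fun j hj => linear_mem (hx j hj))
  have eval_p (n : ℕ) (z : ℂ) : (p n).eval z = c * z ^ m *
      ((1 + (-(α : ℂ) * z ^ 2) / n) ^ n * (1 + (γ * z) / n) ^ n) * ∏ j ∈ s, (1 - x j * z) := by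
    simp only [p, eval_mul, eval_C, eval_pow, eval_X, eval_sub, eval_one, eval_prod]
    push_cast
    ring_nf
  refine mem_closure_of_tendsto (tendsto_taylorSeries (l := atTop)
    (G := fun n z => (p n).eval z) (M := ‖c‖ * (Real.exp α * Real.exp ‖γ‖) * ∏ j ∈ s, (1 + ‖x j‖))
    (fun n => (p n).differentiable) (by fun_prop) (fun n z hz => ?_) fun z _ => ?_)
    (.of_forall fun n => ⟨p n, p_mem n, (taylorSeries_eval (p n)).symm⟩)
  · rw [eval_p]
    simp only [norm_mul, norm_prod, norm_pow z, hz, one_pow, mul_one]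
    gcongr with j
    · exact (norm_one_add_div_pow_le _ n).trans_eq (by simp [hz, abs_of_nonneg hα])
    · simpa [hz] using norm_one_add_div_pow_le (γ * z) n
    · simpa [hz] using norm_sub_le 1 (x j * z)
  · simp only [eval_p, Complex.exp_add]
    exact (((Complex.tendsto_one_add_div_pow_exp _).mul
      (Complex.tendsto_one_add_div_pow_exp _)).const_mul _).mul_const _

lemma taylorSeries_exp_mul_prod_weierstrassFactor_mem_closure {ι : Type*} (s : Finset ι)
    {x : ι → ℂ} (hx : ∀ j ∈ s, x j ∈ closedLowerHalfPlane) (c : ℂ) (m : ℕ) {α : ℝ} (hα : 0 ≤ α)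
    {β : ℂ} (hβ : -∑ j ∈ s, (x j).im ≤ β.im) :
    taylorSeries (fun z => c * z ^ m * Complex.exp (-(α : ℂ) * z ^ 2 + β * z) *
      ∏ j ∈ s, weierstrassFactor 1 (x j * z)) ∈
      closure (coeToPowerSeries.ringHom '' (rootsIn closedUpperHalfPlane : Set ℂ[X])) := by
  convert taylorSeries_exp_mul_prod_mem_closure s hx c m hα (γ := β + ∑ j ∈ s, x j) ?_ using 3
    with z
  · rw [prod_one_sub_mul_eq, ← mul_assoc, mul_assoc _ (Complex.exp _) (Complex.exp _),
      ← Complex.exp_add]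
    ring_nf
  · rw [Complex.add_im, Complex.im_sum]
    linarith

end WeakLimits

section PolyaObrechkoff

open scoped PowerSeries.WithPiTopology

lemma mem_PolyaObrechkoff {ι : Type} [Countable ι] {x : ι → ℂ}
    (hx : ∀ j, x j ∈ closedLowerHalfPlane) (hx_sq : Summable fun j => ‖x j‖ ^ 2)
    (hx_im : Summable fun j => (x j).im) {α : ℝ} (hα : 0 ≤ α) {β : ℂ}
    (hβ : -∑' j, (x j).im ≤ β.im) :
    (fun z => Complex.exp (-(α : ℂ) * z ^ 2 + β * z) * ∏' j, weierstrassFactor 1 (x j * z)) ∈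
      PolyaObrechkoff := by
  have hdiff := differentiable_tprod_weierstrassFactor (n := 1) hx_sq
  let s : Set ι := {j | x j ≠ 0}
  refine ⟨by fun_prop, 1, 0, α, β, s, inferInstance, fun j => (x j)⁻¹, hα,
    fun j => ⟨inv_mem_closedUpperHalfPlane.mpr (hx j), inv_ne_zero j.2⟩, ?_, ?_, ?_, fun z => ?_⟩
  · exact (hx_sq.subtype s).congr fun j => by simp
  · exact (hx_im.subtype s).neg.congr fun j => by simp
  · have hsupport : Function.support (fun j => (x j).im) ⊆ s := fun j hj h0 => hj (by simp [h0])
    simpa [tsum_neg, tsum_subtype_eq_of_support_subset hsupport] using hβ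
  · have hprod := (multipliable_weierstrassFactor (n := 1) hx_sq z).hasProd
    rw [← hasProd_subtype_iff_of_mulSupport_subset (s := s)
      fun j hj h0 => hj (by simp [h0, weierstrassFactor_one])] at hprod
    refine ⟨_, hprod.congr_fun fun j => ?_, by simp⟩
    simp [weierstrassFactor_one, div_eq_mul_inv, mul_comm]

lemma const_mul_pow_mul_mem_PolyaObrechkoff {F : ℂ → ℂ} (hF : F ∈ PolyaObrechkoff) (c : ℂ)
    (m : ℕ) : (fun z => c * z ^ m * F z) ∈ PolyaObrechkoff := by
  obtain ⟨hdiff, c', m', α, β, ι, hι, a, hα, ha, hsum_sq, hsum_im, hβ, hprod⟩ := hF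
  refine ⟨by fun_prop, c * c', m + m', α, β, ι, hι, a, hα, ha, hsum_sq, hsum_im, hβ, fun z => ?_⟩
  obtain ⟨P, hP, hFz⟩ := hprod z
  exact ⟨P, hP, by simp only [hFz]; ring⟩

lemma zero_mem_PolyaObrechkoff : 0 ∈ PolyaObrechkoff := by
  have h := mem_PolyaObrechkoff (ι := Empty) (x := isEmptyElim) (α := 0) (β := 0) isEmptyElim
    summable_empty summable_empty le_rfl (by simp)
  convert const_mul_pow_mul_mem_PolyaObrechkoff h 0 0 using 1
  ext
  simp

lemma taylorSeries_mem_closure_of_mem_PolyaObrechkoff {F : ℂ → ℂ} (hF : F ∈ PolyaObrechkoff) :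
    taylorSeries F ∈
      closure (coeToPowerSeries.ringHom '' (rootsIn closedUpperHalfPlane : Set ℂ[X])) := by
  obtain ⟨hdiff, c, m, α, β, ι, hι, a, hα, ha, hsum_sq, hsum_im, hβ, hprod⟩ := hF
  choose P hP hFP using hprod
  have inv_mem (j : ι) : (a j)⁻¹ ∈ closedLowerHalfPlane :=
    inv_mem_closedUpperHalfPlane.mp ((inv_inv (a j)).symm ▸ (ha j).1)
  have factor_eq (j : ι) (z : ℂ) :
      (1 - z / a j) * Complex.exp (z / a j) = weierstrassFactor 1 ((a j)⁻¹ * z) := by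
    rw [weierstrassFactor_one, div_eq_inv_mul]
  simp only [factor_eq] at hP
  rw [← closure_closure]
  refine mem_closure_of_tendsto (tendsto_taylorSeries (l := (atTop : Filter (Finset ι)))
    (G := fun s z => c * z ^ m * Complex.exp (-(α : ℂ) * z ^ 2 + β * z) *
      ∏ j ∈ s, weierstrassFactor 1 ((a j)⁻¹ * z))
    (M := ‖c‖ * Real.exp (α + ‖β‖) * Real.exp ((∑' j, (‖a j‖ ^ 2)⁻¹) / 2)) (fun s => ?_) hdiff
    (fun s z hz => ?_) fun z _ => ?_) (.of_forall fun s => ?_)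
  · simp only [weierstrassFactor_one]
    fun_prop
  · rw [norm_mul, norm_mul, norm_mul, norm_pow, hz, one_pow, mul_one]
    gcongr
    · refine (Complex.norm_exp_le_exp_norm _).trans (Real.exp_le_exp.mpr ?_)
      exact (norm_add_le _ _).trans_eq (by simp [hz, abs_of_nonneg hα])
    · refine (norm_prod_weierstrassFactor_one_le s _ z).trans (Real.exp_le_exp.mpr ?_)
      have := hsum_sq.sum_le_tsum s fun j _ => by positivity
      simpa [hz] using div_le_div_of_nonneg_right this zero_le_two
  · rw [hFP z]
    exact (hP z).const_mul _
  · refine taylorSeries_exp_mul_prod_weierstrassFactor_mem_closure s (fun j _ => inv_mem j) c m hα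
      (le_trans ?_ hβ)
    have hsum := hsum_im.sum_le_tsum s fun j _ =>
      (neg_nonneg.mpr (inv_mem j) : 0 ≤ -((a j)⁻¹).im)
    simpa only [Complex.neg_im, Finset.sum_neg_distrib] using hsum

end PolyaObrechkoff

section ReciprocalRootBounds

variable {ι : Type*} {x : ι → ℂ}

lemma hasProd_weierstrassFactor_one {z P b : ℂ} (hP : HasProd (fun j => 1 - x j * z) P)
    (hb : HasSum x b) :
    HasProd (fun j => weierstrassFactor 1 (x j * z)) (P * Complex.exp (b * z)) := by
  simp only [weierstrassFactor_one]
  exact hP.mul (hb.mul_right z).cexp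

lemma weierstrassFactor_two (u : ℂ) :
    weierstrassFactor 2 u = weierstrassFactor 1 u * Complex.exp (u ^ 2 / 2) := by
  rw [weierstrassFactor_one, mul_assoc, ← Complex.exp_add, weierstrassFactor,
    Finset.sum_range_succ, Finset.sum_range_one]
  norm_num

lemma hasProd_weierstrassFactor_two {z Q s : ℂ}
    (hQ : HasProd (fun j => weierstrassFactor 1 (x j * z)) Q) (hs : HasSum (fun j => x j ^ 2) s) :
    HasProd (fun j => weierstrassFactor 2 (x j * z)) (Q * Complex.exp (s * z ^ 2 / 2)) := by
  simp only [weierstrassFactor_two, mul_pow]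
  exact hQ.mul ((hs.mul_right (z ^ 2)).div_const 2).cexp

lemma norm_le_of_hasProd_one_sub_mul {z P b : ℂ} (hP : HasProd (fun j => 1 - x j * z) P)
    (hb : HasSum x b) {C : ℝ} (hC : ∀ t : Finset ι, ∑ j ∈ t, ‖x j‖ ^ 2 ≤ C) :
    ‖P‖ ≤ Real.exp (‖b‖ * ‖z‖ + C * ‖z‖ ^ 2 / 2) := by
  have hQ : ‖P * Complex.exp (b * z)‖ ≤ Real.exp (C * ‖z‖ ^ 2 / 2) :=
    le_of_tendsto' (Tendsto.norm (hasProd_weierstrassFactor_one hP hb)) fun t =>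
      (norm_prod_weierstrassFactor_one_le t x z).trans (by gcongr; exact hC t)
  calc ‖P‖ = ‖Complex.exp (-(b * z))‖ * ‖P * Complex.exp (b * z)‖ := by
        rw [← norm_mul, mul_left_comm, ← Complex.exp_add, neg_add_cancel, Complex.exp_zero, mul_one]
    _ ≤ Real.exp (‖b‖ * ‖z‖) * Real.exp (C * ‖z‖ ^ 2 / 2) := by
        gcongr
        exact (Complex.norm_exp_le_exp_norm _).trans_eq (by rw [norm_neg, norm_mul])
    _ = Real.exp (‖b‖ * ‖z‖ + C * ‖z‖ ^ 2 / 2) := (Real.exp_add _ _).symm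

lemma im_le_sum_im_of_hasSum (hx : ∀ j, x j ∈ closedLowerHalfPlane) {b : ℂ} (hb : HasSum x b)
    (t : Finset ι) : b.im ≤ ∑ j ∈ t, (x j).im := by
  have := sum_le_hasSum t (fun j _ => neg_nonneg.mpr (hx j)) (Complex.hasSum_im hb).neg
  simpa only [Finset.sum_neg_distrib, neg_le_neg_iff] using this

lemma sum_norm_sq_le_of_hasSum (hx : ∀ j, x j ∈ closedLowerHalfPlane) {b s : ℂ} (hb : HasSum x b)
    (hs : HasSum (fun j => x j ^ 2) s) (t : Finset ι) :
    ∑ j ∈ t, ‖x j‖ ^ 2 ≤ s.re + 2 * b.im ^ 2 := by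
  have hsum : HasSum (fun j => (x j ^ 2).re + 2 * b.im * (x j).im) (s.re + 2 * b.im ^ 2) := by
    rw [sq b.im, ← mul_assoc]
    exact (Complex.hasSum_re hs).add ((Complex.hasSum_im hb).mul_left (2 * b.im))
  have norm_sq_le (j : ι) : ‖x j‖ ^ 2 ≤ (x j ^ 2).re + 2 * b.im * (x j).im := by
    have him : b.im ≤ (x j).im := by simpa using im_le_sum_im_of_hasSum hx hb {j}
    have hsq : ‖x j‖ ^ 2 = (x j ^ 2).re + 2 * (x j).im * (x j).im := by
      rw [← Complex.normSq_eq_norm_sq, Complex.normSq_apply, sq (x j), Complex.mul_re]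
      ring
    linarith [mul_le_mul_of_nonpos_right him (hx j)]
  exact (Finset.sum_le_sum fun j _ => norm_sq_le j).trans
    (sum_le_hasSum t (fun j _ => (sq_nonneg _).trans (norm_sq_le j)) hsum)

open scoped ComplexOrder in
lemma infDist_nonneg_le_of_hasSum_sq (hx : ∀ j, x j ∈ closedLowerHalfPlane) {ε : ℝ}
    (hε0 : 0 ≤ ε) (hε : ∀ j, ‖x j‖ ≤ ε) {b s : ℂ} (hb : HasSum x b)
    (hs : HasSum (fun j => x j ^ 2) s) :
    Metric.infDist s {z : ℂ | 0 ≤ z} ≤ 2 * ε * -b.im := by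
  have sq_sub_norm_sq (u : ℂ) : ‖u ^ 2 - (‖u‖ ^ 2 : ℝ)‖ = 2 * ‖u‖ * |u.im| := by
    rw [← Complex.normSq_eq_norm_sq, Complex.normSq_eq_conj_mul_self, sq, ← sub_mul,
      Complex.sub_conj, norm_mul, norm_mul, Complex.norm_I, Complex.norm_real, Real.norm_eq_abs,
      abs_mul, abs_two]
    ring
  refine le_of_tendsto' ((Metric.continuous_infDist_pt _).continuousAt.tendsto.comp hs) fun t => ?_
  have hmem : ((∑ j ∈ t, ‖x j‖ ^ 2 : ℝ) : ℂ) ∈ {z : ℂ | 0 ≤ z} :=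
    Complex.zero_le_real.mpr (by positivity)
  calc Metric.infDist (∑ j ∈ t, x j ^ 2) {z : ℂ | 0 ≤ z}
      ≤ ‖∑ j ∈ t, x j ^ 2 - ((∑ j ∈ t, ‖x j‖ ^ 2 : ℝ) : ℂ)‖ :=
        (Metric.infDist_le_dist_of_mem hmem).trans_eq (dist_eq_norm _ _)
    _ ≤ ∑ j ∈ t, 2 * ‖x j‖ * |(x j).im| := by
        simp only [← sq_sub_norm_sq, Complex.ofReal_sum, ← Finset.sum_sub_distrib]
        exact norm_sum_le _ _
    _ ≤ ∑ j ∈ t, 2 * ε * -(x j).im := by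
        gcongr with j
        · exact hε j
        · exact (abs_of_nonpos (hx j)).le
    _ ≤ 2 * ε * -b.im := by
        rw [← Finset.mul_sum, Finset.sum_neg_distrib]
        gcongr
        exact im_le_sum_im_of_hasSum hx hb t

end ReciprocalRootBounds

section SortedByNorm

@[to_additive]
lemma hasProd_comp_getD {α M : Type*} [CommMonoid M] [TopologicalSpace M] (l : List α) {d : α}
    {f : α → M} (hf : f d = 1) : HasProd (fun j => f (l.getD j d)) (l.map f).prod := by
  have hprod : (l.map f).prod = ∏ j ∈ Finset.range l.length, f (l.getD j d) := by
    simp [← Fin.prod_univ_eq_prod_range, ← Fin.prod_univ_fun_getElem]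
  rw [hprod]
  refine hasProd_prod_of_ne_finset_one fun j hj => ?_
  rw [List.getD_eq_default _ _ (by simpa using hj), hf]

variable {E : Type*} [SeminormedAddGroup E]

lemma antitone_norm_getD_zero {l : List E} (hl : l.Pairwise fun x y => ‖y‖ ≤ ‖x‖) :
    Antitone fun j => ‖l.getD j 0‖ := by
  intro i j hij
  beta_reduce
  obtain hj | hj := le_or_gt l.length j
  · rw [List.getD_eq_default _ _ hj, norm_zero]
    exact norm_nonneg _
  · rw [List.getD_eq_getElem _ _ hj, List.getD_eq_getElem _ _ (hij.trans_lt hj)]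
    obtain rfl | hlt := hij.eq_or_lt
    · exact le_rfl
    · exact List.pairwise_iff_getElem.mp hl i j _ _ hlt

open scoped Classical in
/-- The elements of `s`, repeated according to multiplicity, in order of decreasing norm, and
continued by zeros to an infinite sequence. -/
noncomputable def sortedByNorm (s : Multiset E) (j : ℕ) : E :=
  (s.toList.insertionSort fun x y => ‖y‖ ≤ ‖x‖).getD j 0

lemma antitone_norm_sortedByNorm (s : Multiset E) : Antitone fun j => ‖sortedByNorm s j‖ := by
  classical
  let r (x y : E) : Prop := ‖y‖ ≤ ‖x‖
  have : Std.Total r := ⟨fun x y => le_total _ _⟩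
  have : IsTrans E r := ⟨fun x y z hxy hyz => le_trans hyz hxy⟩
  exact antitone_norm_getD_zero (List.pairwise_insertionSort r _)

@[to_additive]
lemma hasProd_comp_sortedByNorm {M : Type*} [CommMonoid M] [TopologicalSpace M] (s : Multiset E)
    {f : E → M} (hf : f 0 = 1) : HasProd (fun j => f (sortedByNorm s j)) (s.map f).prod := by
  classical
  have hperm := List.perm_insertionSort (fun x y : E => ‖y‖ ≤ ‖x‖) s.toList
  have hprod : (s.map f).prod = ((s.toList.insertionSort fun x y => ‖y‖ ≤ ‖x‖).map f).prod := by
    rw [(hperm.map f).prod_eq, ← Multiset.prod_coe, ← Multiset.map_coe, Multiset.coe_toList]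
  rw [hprod]
  exact hasProd_comp_getD _ hf

lemma sortedByNorm_mem {s : Multiset E} {S : Set E} (h0 : 0 ∈ S) (hs : ∀ x ∈ s, x ∈ S) (j : ℕ) :
    sortedByNorm s j ∈ S := by
  classical
  rw [sortedByNorm, List.getD_eq_getElem?_getD]
  cases h : (s.toList.insertionSort fun x y => ‖y‖ ≤ ‖x‖)[j]? with
  | none => exact h0
  | some x => exact hs x (by simpa using List.mem_of_getElem? h)

end SortedByNorm

section ReciprocalRoots

section CommRing

variable {R : Type*} [CommRing R] (s : Multiset R)

lemma coeff_zero_prod_one_sub_C_mul_X : (s.map fun x => 1 - C x * X).prod.coeff 0 = 1 := by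
  simp [coeff_zero_eq_eval_zero, eval_multiset_prod]

lemma coeff_succ_one_sub_C_mul_X_mul (x : R) (q : R[X]) (k : ℕ) :
    ((1 - C x * X) * q).coeff (k + 1) = q.coeff (k + 1) - x * q.coeff k := by
  rw [sub_mul, one_mul, mul_assoc, coeff_sub, coeff_C_mul, coeff_X_mul]

lemma coeff_one_prod_one_sub_C_mul_X : (s.map fun x => 1 - C x * X).prod.coeff 1 = -s.sum := by
  induction s using Multiset.induction with
  | empty => simp [coeff_one]
  | cons x s ih =>
    rw [Multiset.map_cons, Multiset.prod_cons, coeff_succ_one_sub_C_mul_X_mul,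
      coeff_zero_prod_one_sub_C_mul_X, ih, Multiset.sum_cons]
    ring

lemma two_mul_coeff_two_prod_one_sub_C_mul_X :
    2 * (s.map fun x => 1 - C x * X).prod.coeff 2 = s.sum ^ 2 - (s.map (· ^ 2)).sum := by
  induction s using Multiset.induction with
  | empty => simp [coeff_one]
  | cons x s ih =>
    rw [Multiset.map_cons, Multiset.prod_cons, coeff_succ_one_sub_C_mul_X_mul, mul_sub, ih,
      coeff_one_prod_one_sub_C_mul_X, Multiset.map_cons, Multiset.sum_cons, Multiset.sum_cons]
    ring

end CommRing

lemma prod_one_sub_C_mul_X_inv_roots {K : Type*} [Field K] {p : K[X]} (hp : p.Splits)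
    (h0 : p.coeff 0 = 1) : ((p.roots.map (·⁻¹)).map fun x => 1 - C x * X).prod = p := by
  have factor_eq (r : K) (hr : r ∈ p.roots) : X - C r = C (-r) * (1 - C r⁻¹ * X) := by
    have hr0 : r ≠ 0 := by
      rintro rfl
      rw [coeff_zero_eq_eval_zero, (isRoot_of_mem_roots hr).eq_zero] at h0
      exact zero_ne_one h0
    rw [mul_sub, ← mul_assoc, ← C_mul, neg_mul, mul_inv_cancel₀ hr0]
    simp [sub_eq_neg_add, add_comm]
  have hprod : p = C (p.leadingCoeff * (p.roots.map fun r => -r).prod) *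
      ((p.roots.map (·⁻¹)).map fun x => 1 - C x * X).prod := by
    conv_lhs => rw [hp.eq_prod_roots, Multiset.map_congr rfl factor_eq]
    rw [Multiset.prod_map_mul, C_mul, mul_assoc, Multiset.map_map, map_multiset_prod,
      Multiset.map_map]
    rfl
  have hconst : p.leadingCoeff * (p.roots.map fun r => -r).prod = 1 := by
    rw [hprod, coeff_C_mul, coeff_zero_prod_one_sub_C_mul_X, mul_one] at h0
    exact h0
  rw [hconst, C_1, one_mul] at hprod
  exact hprod.symm

lemma exists_eq_prod_one_sub_C_mul_X {p : ℂ[X]} (hp : p ∈ rootsIn closedUpperHalfPlane)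
    (h0 : p.coeff 0 = 1) :
    ∃ s : Multiset ℂ, (∀ x ∈ s, x ∈ closedLowerHalfPlane) ∧
      p = (s.map fun x => 1 - C x * X).prod := by
  refine ⟨_, fun x hx => ?_, (prod_one_sub_C_mul_X_inv_roots (IsAlgClosed.splits p) h0).symm⟩
  obtain ⟨r, hr, rfl⟩ := Multiset.mem_map.mp hx
  exact inv_mem_closedUpperHalfPlane.mp ((inv_inv r).symm ▸ hp r hr)

lemma exists_reciprocalRoots {p : ℂ[X]} (hp : p ∈ rootsIn closedUpperHalfPlane)
    (h0 : p.coeff 0 = 1) :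
    ∃ x : ℕ → ℂ, (∀ j, x j ∈ closedLowerHalfPlane) ∧ (Antitone fun j => ‖x j‖) ∧
      (∀ z, HasProd (fun j => 1 - x j * z) (p.eval z)) ∧ HasSum x (-p.coeff 1) ∧
      HasSum (fun j => x j ^ 2) (p.coeff 1 ^ 2 - 2 * p.coeff 2) := by
  obtain ⟨s, hs, rfl⟩ := exists_eq_prod_one_sub_C_mul_X hp h0
  refine ⟨sortedByNorm s, sortedByNorm_mem (le_refl (0 : ℝ)) hs, antitone_norm_sortedByNorm s,
    fun z => ?_, ?_, ?_⟩
  · convert hasProd_comp_sortedByNorm s (f := fun x => 1 - x * z) (by simp) using 1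
    simp [eval_multiset_prod]
  · simpa [coeff_one_prod_one_sub_C_mul_X] using hasSum_comp_sortedByNorm s (f := id) rfl
  · convert hasSum_comp_sortedByNorm s (f := (· ^ 2)) (zero_pow two_ne_zero) using 1
    rw [two_mul_coeff_two_prod_one_sub_C_mul_X, coeff_one_prod_one_sub_C_mul_X]
    ring

end ReciprocalRoots

section LimitsOfReciprocalRoots

lemma le_sqrt_div_of_antitone {u : ℕ → ℝ} (hu : Antitone u) (hu0 : ∀ j, 0 ≤ u j) {C : ℝ}
    (hC : ∀ t : Finset ℕ, ∑ j ∈ t, u j ^ 2 ≤ C) (j : ℕ) : u j ≤ √(C / (j + 1)) := by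
  refine Real.le_sqrt_of_sq_le ((le_div_iff₀ (by positivity)).mpr ?_)
  calc u j ^ 2 * (j + 1) = ∑ _k ∈ Finset.range (j + 1), u j ^ 2 := by
        simp [mul_comm]
    _ ≤ ∑ k ∈ Finset.range (j + 1), u k ^ 2 :=
        Finset.sum_le_sum fun k hk =>
          pow_le_pow_left₀ (hu0 j) (hu (Nat.lt_succ_iff.mp (Finset.mem_range.mp hk))) 2
    _ ≤ C := hC _

lemma tendsto_sqrt_div_add_one (C : ℝ) : Tendsto (fun j : ℕ => √(C / (j + 1))) atTop (𝓝 0) := by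
  refine (Real.continuous_sqrt.tendsto' 0 0 Real.sqrt_zero).comp ?_
  exact_mod_cast (tendsto_const_div_atTop_nhds_zero_nat C).comp (tendsto_add_atTop_nat 1)

lemma summable_sqrt_div_pow_three (C : ℝ) : Summable fun j : ℕ => √(C / (j + 1)) ^ 3 := by
  refine (((Real.summable_one_div_nat_add_rpow 1 (3 / 2)).mpr (by norm_num)).mul_left
    (√C ^ 3)).congr fun j => ?_
  have hj : (0 : ℝ) ≤ (j : ℝ) + 1 := by positivity
  have hpow : |(j : ℝ) + 1| ^ (3 / 2 : ℝ) = √((j : ℝ) + 1) ^ 3 := by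
    rw [abs_of_nonneg hj, Real.sqrt_eq_rpow, ← Real.rpow_natCast, ← Real.rpow_mul hj]
    norm_num
  rw [Real.sqrt_div' _ hj, div_pow, hpow, mul_one_div]

variable {κ : Type*} {l : Filter κ} [l.NeBot] {x : κ → ℕ → ℂ} {v : ℕ → ℂ} {b s : κ → ℂ} {β σ : ℂ}
  (hx : ∀ i j, x i j ∈ closedLowerHalfPlane) (hb : ∀ i, HasSum (x i) (b i))
  (hxv : ∀ j, Tendsto (fun i => x i j) l (𝓝 (v j))) (hbβ : Tendsto b l (𝓝 β))

include hx hxv in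
lemma mem_closedLowerHalfPlane_of_tendsto (j : ℕ) : v j ∈ closedLowerHalfPlane :=
  (isClosed_le Complex.continuous_im continuous_const).mem_of_tendsto (hxv j)
    (.of_forall fun i => hx i j)

include hx hb hxv hbβ in
lemma im_le_sum_im_of_tendsto (t : Finset ℕ) : β.im ≤ ∑ j ∈ t, (v j).im :=
  le_of_tendsto_of_tendsto' ((Complex.continuous_im.tendsto β).comp hbβ)
    (tendsto_finsetSum t fun j _ => (Complex.continuous_im.tendsto (v j)).comp (hxv j))
    fun i => im_le_sum_im_of_hasSum (hx i) (hb i) t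

include hx hb hxv hbβ in
lemma summable_im_of_tendsto : Summable fun j => (v j).im := by
  have hv := mem_closedLowerHalfPlane_of_tendsto hx hxv
  refine summable_neg_iff.mp (summable_of_sum_le (c := -β.im) (fun j => neg_nonneg.mpr (hv j))
    fun t => ?_)
  rw [Finset.sum_neg_distrib]
  exact neg_le_neg (im_le_sum_im_of_tendsto hx hb hxv hbβ t)

open scoped ComplexOrder in
include hx hb hxv hbβ in
lemma hasSum_sq_le_of_tendsto (hs : ∀ i, HasSum (fun j => x i j ^ 2) (s i))
    (hsσ : Tendsto s l (𝓝 σ)) (hanti : ∀ i, Antitone fun j => ‖x i j‖) {r : ℕ → ℝ}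
    (hr : Tendsto r atTop (𝓝 0)) (hxr : ∀ i j, ‖x i j‖ ≤ r j) {τ : ℂ}
    (hτ : HasSum (fun j => v j ^ 2) τ) : τ ≤ σ := by
  have infDist_tail_le (n : ℕ) (i : κ) :
      Metric.infDist (s i - ∑ j ∈ Finset.range n, x i j ^ 2) {z : ℂ | 0 ≤ z} ≤
        2 * r n * -(b i).im := by
    have hrn : 0 ≤ r n := (norm_nonneg _).trans (hxr i n)
    refine (infDist_nonneg_le_of_hasSum_sq (x := fun j => x i (j + n)) (fun j => hx i _) hrn
      (fun j => (hanti i (Nat.le_add_left n j)).trans (hxr i n))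
      ((hasSum_nat_add_iff' n).mpr (hb i)) ((hasSum_nat_add_iff' n).mpr (hs i))).trans ?_
    have him : ∑ j ∈ Finset.range n, (x i j).im ≤ 0 := Finset.sum_nonpos fun j _ => hx i j
    rw [Complex.sub_im, Complex.im_sum]
    gcongr
    linarith
  have infDist_limit_tail_le (n : ℕ) :
      Metric.infDist (σ - ∑ j ∈ Finset.range n, v j ^ 2) {z : ℂ | 0 ≤ z} ≤ 2 * r n * -β.im :=
    le_of_tendsto_of_tendsto'
      (((Metric.continuous_infDist_pt _).tendsto _).comp
        (hsσ.sub (tendsto_finsetSum _ fun j _ => (hxv j).pow 2)))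
      ((((Complex.continuous_im.tendsto β).comp hbβ).neg).const_mul _) (infDist_tail_le n)
  have infDist_eq_zero : Metric.infDist (σ - τ) {z : ℂ | 0 ≤ z} ≤ 0 := by
    refine le_of_tendsto_of_tendsto'
      (((Metric.continuous_infDist_pt _).tendsto _).comp (hτ.tendsto_sum_nat.const_sub σ))
      (?_ : Tendsto (fun n => 2 * r n * -β.im) atTop (𝓝 0)) infDist_limit_tail_le
    simpa using (hr.const_mul 2).mul_const (-β.im)
  have hclosed : IsClosed {z : ℂ | 0 ≤ z} := isClosed_Ici
  exact sub_nonneg.mp ((hclosed.mem_iff_infDist_zero ⟨0, le_refl (0 : ℂ)⟩).mpr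
    (infDist_eq_zero.antisymm Metric.infDist_nonneg))

end LimitsOfReciprocalRoots

section EntireLimits

open scoped ComplexOrder PowerSeries.WithPiTopology

lemma eq_exp_mul_tprod_weierstrassFactor_two {x : ℕ → ℂ} {z P b s : ℂ}
    (hP : HasProd (fun j => 1 - x j * z) P) (hb : HasSum x b) (hs : HasSum (fun j => x j ^ 2) s) :
    P = Complex.exp (-(b * z) - s * z ^ 2 / 2) * ∏' j, weierstrassFactor 2 (x j * z) := by
  rw [(hasProd_weierstrassFactor_two (hasProd_weierstrassFactor_one hP hb) hs).tprod_eq, mul_assoc,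
    mul_left_comm, ← Complex.exp_add, ← Complex.exp_add]
  ring_nf
  simp

variable {κ : Type*} {l : Filter κ} [l.NeBot] {x : κ → ℕ → ℂ}
  {v : ℕ → ℂ} {b s : κ → ℂ} {β σ : ℂ} {C : ℝ}

lemma exists_mem_PolyaObrechkoff_tendsto_eval (hx : ∀ i j, x i j ∈ closedLowerHalfPlane)
    (hb : ∀ i, HasSum (x i) (b i)) (hs : ∀ i, HasSum (fun j => x i j ^ 2) (s i))
    (hanti : ∀ i, Antitone fun j => ‖x i j‖) (hC : ∀ i (t : Finset ℕ), ∑ j ∈ t, ‖x i j‖ ^ 2 ≤ C)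
    (hxv : ∀ j, Tendsto (fun i => x i j) l (𝓝 (v j))) (hbβ : Tendsto b l (𝓝 β))
    (hsσ : Tendsto s l (𝓝 σ)) :
    ∃ F ∈ PolyaObrechkoff, ∀ (P : κ → ℂ) z, (∀ i, HasProd (fun j => 1 - x i j * z) (P i)) →
      Tendsto P l (𝓝 (F z)) := by
  have norm_le (i : κ) (j : ℕ) : ‖x i j‖ ≤ √(C / (j + 1)) :=
    le_sqrt_div_of_antitone (hanti i) (fun _ => norm_nonneg _) (hC i) j
  have hv_sq : Summable fun j => ‖v j‖ ^ 2 :=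
    summable_of_sum_le (fun j => sq_nonneg ‖v j‖) fun t =>
      le_of_tendsto' (tendsto_finsetSum t fun j _ => (hxv j).norm.pow 2) fun i => hC i t
  have hτ : HasSum (fun j => v j ^ 2) (∑' j, v j ^ 2) :=
    (Summable.of_norm (by simpa only [norm_pow] using hv_sq)).hasSum
  obtain ⟨α, hα, hασ⟩ : ∃ α : ℝ, 0 ≤ α ∧ (α : ℂ) = (σ - ∑' j, v j ^ 2) / 2 := by
    refine ⟨‖σ - ∑' j, v j ^ 2‖ / 2, by positivity, ?_⟩
    push_cast
    rw [← Complex.eq_coe_norm_of_nonneg (sub_nonneg.mpr (hasSum_sq_le_of_tendsto hx hb hxv hbβ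
      hs hsσ hanti (tendsto_sqrt_div_add_one C) norm_le hτ))]
  have hv_im := summable_im_of_tendsto hx hb hxv hbβ
  refine ⟨_, mem_PolyaObrechkoff (β := -β) (mem_closedLowerHalfPlane_of_tendsto hx hxv) hv_sq
    hv_im hα ?_, fun P z hP => ?_⟩
  · exact neg_le_neg (ge_of_tendsto' hv_im.hasSum (im_le_sum_im_of_tendsto hx hb hxv hbβ))
  · have hF : Complex.exp (-(α : ℂ) * z ^ 2 + -β * z) * ∏' j, weierstrassFactor 1 (v j * z) =
        Complex.exp (-(β * z) - σ * z ^ 2 / 2) * ∏' j, weierstrassFactor 2 (v j * z) := by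
      rw [(hasProd_weierstrassFactor_two
        (multipliable_weierstrassFactor (n := 1) hv_sq z).hasProd hτ).tprod_eq, mul_left_comm,
        ← Complex.exp_add, mul_comm, hασ]
      congr 2
      ring
    rw [hF, funext fun i => eq_exp_mul_tprod_weierstrassFactor_two (hP i) (hb i) (hs i)]
    exact (Tendsto.cexp ((hbβ.mul_const z).neg.sub ((hsσ.mul_const _).div_const 2))).mul
      (tendsto_tprod_weierstrassFactor (n := 2) (summable_sqrt_div_pow_three C) norm_le hxv z)

lemma exists_mem_PolyaObrechkoff_represents_of_tendsto {p : ℕ → ℂ[X]} {g : PowerSeries ℂ}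
    (hp : ∀ i, p i ∈ rootsIn closedUpperHalfPlane) (h0 : ∀ i, (p i).coeff 0 = 1)
    (hg : Tendsto (fun i => (p i : PowerSeries ℂ)) atTop (𝓝 g)) :
    ∃ F ∈ PolyaObrechkoff, Represents g F := by
  choose x hx hanti hprod hb hs using fun i => exists_reciprocalRoots (hp i) (h0 i)
  have tendsto_coeff (k : ℕ) :
      Tendsto (fun i => (p i).coeff k) atTop (𝓝 (PowerSeries.coeff k g)) := by
    simpa only [coeff_coe] using
      (PowerSeries.WithPiTopology.tendsto_iff_coeff_tendsto _ _ _ _).mp hg k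
  have hb_lim := (tendsto_coeff 1).neg
  have hs_lim := ((tendsto_coeff 1).pow 2).sub ((tendsto_coeff 2).const_mul 2)
  obtain ⟨B, hB⟩ := hb_lim.norm.bddAbove_range
  obtain ⟨C, hC⟩ : ∃ C : ℝ, ∀ i (t : Finset ℕ), ∑ j ∈ t, ‖x i j‖ ^ 2 ≤ C := by
    obtain ⟨C, hC⟩ := (((Complex.continuous_re.tendsto _).comp hs_lim).add
      ((((Complex.continuous_im.tendsto _).comp hb_lim).pow 2).const_mul 2)).bddAbove_range
    exact ⟨C, fun i t => (sum_norm_sq_le_of_hasSum (hx i) (hb i) (hs i) t).trans (hC ⟨i, rfl⟩)⟩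
  obtain ⟨v, -, ns, hns, hv⟩ := (isCompact_univ_pi fun _ : ℕ =>
    isCompact_closedBall (0 : ℂ) √C).tendsto_subseq (x := x) fun i j _ =>
      mem_closedBall_zero_iff.mpr (Real.le_sqrt_of_sq_le (by simpa using hC i {j}))
  obtain ⟨F, hF, hlim⟩ := exists_mem_PolyaObrechkoff_tendsto_eval (fun i => hx (ns i))
    (fun i => hb (ns i)) (fun i => hs (ns i)) (fun i => hanti (ns i)) (fun i => hC (ns i))
    (tendsto_pi_nhds.mp hv) (hb_lim.comp hns.tendsto_atTop) (hs_lim.comp hns.tendsto_atTop)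
  have norm_eval_le (i : ℕ) (z : ℂ) (hz : ‖z‖ = 1) : ‖(p i).eval z‖ ≤ Real.exp (B + C / 2) := by
    refine (norm_le_of_hasProd_one_sub_mul (hprod i z) (hb i) (hC i)).trans ?_
    rw [hz, mul_one, one_pow, mul_one]
    gcongr
    exact hB ⟨i, rfl⟩
  have hFg : taylorSeries F = g := by
    refine tendsto_nhds_unique (tendsto_taylorSeries (fun i => (p (ns i)).differentiable) hF.1
      (fun i => norm_eval_le (ns i)) fun z _ => hlim _ z fun i => hprod (ns i) z) ?_
    simp only [taylorSeries_eval]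
    exact hg.comp hns.tendsto_atTop
  exact ⟨F, hF, hFg ▸ represents_taylorSeries hF.1⟩

end EntireLimits

section JensenPolynomials

open scoped PowerSeries.WithPiTopology

lemma exists_mem_PolyaObrechkoff_represents_of_coeff_zero_eq_one {g : PowerSeries ℂ}
    (hg : ∀ n, jensenPolynomial g n ∈ rootsIn closedUpperHalfPlane)
    (h0 : PowerSeries.coeff 0 g = 1) : ∃ F ∈ PolyaObrechkoff, Represents g F := by
  refine exists_mem_PolyaObrechkoff_represents_of_tendsto
    (p := fun n => (jensenPolynomial g (n + 1)).comp (C ((n + 1 : ℕ) : ℂ)⁻¹ * X))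
    (fun n => comp_C_mul_X_mem_rootsIn (hg _) fun z hz => ?_) (fun n => ?_)
    ((tendsto_jensenPolynomial_comp g).comp (tendsto_add_atTop_nat 1))
  · change 0 ≤ (((n + 1 : ℕ) : ℂ)⁻¹ * z).im at hz
    rw [← Complex.ofReal_natCast, ← Complex.ofReal_inv, Complex.im_ofReal_mul] at hz
    exact nonneg_of_mul_nonneg_right hz (by positivity)
  · rw [comp_C_mul_X_coeff, coeff_jensenPolynomial, h0]
    simp

lemma exists_eq_C_mul_X_pow_mul {K : Type*} [Field K] {f : PowerSeries K} (hf : f ≠ 0) :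
    ∃ c ≠ 0, ∃ (m : ℕ) (g : PowerSeries K), PowerSeries.coeff 0 g = 1 ∧
      f = PowerSeries.C c * (PowerSeries.X ^ m * g) := by
  set c := PowerSeries.constantCoeff f.divXPowOrder
  have hc : c ≠ 0 := mt PowerSeries.constantCoeff_divXPowOrder_eq_zero_iff.mp hf
  refine ⟨c, hc, f.order.toNat, PowerSeries.C c⁻¹ * f.divXPowOrder, ?_, ?_⟩
  · rw [PowerSeries.coeff_C_mul, PowerSeries.coeff_zero_eq_constantCoeff, inv_mul_cancel₀ hc]
  · rw [mul_left_comm, ← mul_assoc (PowerSeries.C c), ← map_mul, mul_inv_cancel₀ hc, map_one,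
      one_mul, PowerSeries.X_pow_order_mul_divXPowOrder]

lemma exists_mem_PolyaObrechkoff_represents_of_jensenPolynomial {f : PowerSeries ℂ}
    (hf : ∀ n, jensenPolynomial f n ∈ rootsIn closedUpperHalfPlane) :
    ∃ F ∈ PolyaObrechkoff, Represents f F := by
  obtain rfl | hf0 := eq_or_ne f 0
  · exact ⟨0, zero_mem_PolyaObrechkoff, fun z => by simp⟩
  obtain ⟨c, hc, m, g, hg0, rfl⟩ := exists_eq_C_mul_X_pow_mul hf0
  obtain ⟨F, hF, hgF⟩ := exists_mem_PolyaObrechkoff_represents_of_coeff_zero_eq_one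
    (jensenPolynomial_mem_rootsIn_of_C_mul_X_pow_mul hc m hf) hg0
  refine ⟨_, const_mul_pow_mul_mem_PolyaObrechkoff hF c m, ?_⟩
  have := (represents_coe (C c * X ^ m)).mul hgF
  simpa only [coe_mul, coe_C, coe_pow, coe_X, eval_mul, eval_C, eval_pow, eval_X, mul_assoc] using
    this

end JensenPolynomials

section WeakApproximation

open scoped PowerSeries.WithPiTopology

lemma exists_tendsto_coe_of_mem_closure {R : Type*} [CommSemiring R] [TopologicalSpace R]
    [FirstCountableTopology R] {s : Set R[X]} {f : PowerSeries R}
    (hf : f ∈ closure (coeToPowerSeries.ringHom '' s)) :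
    ∃ p : ℕ → R[X], Tendsto (fun n => (p n : PowerSeries R)) atTop (𝓝 f) ∧ ∀ n, p n ∈ s := by
  have : FirstCountableTopology (PowerSeries R) :=
    inferInstanceAs (FirstCountableTopology ((Unit →₀ ℕ) → R))
  obtain ⟨q, hq, hlim⟩ := mem_closure_iff_seq_limit.mp hf
  choose p hp hpq using hq
  exact ⟨p, (funext hpq : _ = q) ▸ hlim, hp⟩

end WeakApproximation

theorem theorem3p3 (f : PowerSeries ℂ) :
    List.TFAE [
      ∃ F : ℂ → ℂ, F ∈ PolyaObrechkoff ∧ Represents f F,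
      ∃ p : ℕ → Polynomial ℂ,
        ConvergesWeakly (fun n z => (p n).eval z) f ∧
        ∀ n : ℕ, zeroSet (fun z => (p n).eval z) ⊆ closedUpperHalfPlane,
      ∀ n : ℕ, zeroSet (fun z => (jensenPolynomial f n).eval z) ⊆ closedUpperHalfPlane] := by
  simp only [zeroSet_eval_subset_iff, convergesWeakly_iff, taylorSeries_eval]
  tfae_have 1 → 2 := by
    rintro ⟨F, hF, hfF⟩
    exact exists_tendsto_coe_of_mem_closure
      (hfF.taylorSeries_eq ▸ taylorSeries_mem_closure_of_mem_PolyaObrechkoff hF)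
  tfae_have 2 → 3 := fun ⟨p, hlim, hp⟩ => jensenPolynomial_mem_rootsIn_of_tendsto hp hlim
  tfae_have 3 → 1 := exists_mem_PolyaObrechkoff_represents_of_jensenPolynomial
  tfae_finish
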